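/- Let $L:[0,\infty)\to[0,\infty)$ be a physically feasible path loss function, that is, $L(r)\le L(0)<\infty$ for all $r\ge 0$, and $\gamma=\int_0^\infty rL(r)\,dr$ is finite and positive. Suppose that there are $r_0\ge 0$, $\zeta>0$ and $\lambda_c\ge 0$ such that $L$ is decreasing (not necessarily strictly) and differentiable on $[r_0,\infty)$ (one-sidedly at $r_0$) and 1. $\dfrac{rL(r)}{-L'(r)}\ge\zeta$ for all $r\ge r_0$, where the ratio counts as $+\infty$ if $L'(r)=0$ (that is, $rL(r)\ge -\zeta L'(r)$); 2. $\displaystyle\int_{r_0}^\infty \frac{r}{L(r)^2}\,e^{-\pi\lambda_0 r^2}\,dr<\infty$ for all $\lambda_0>\lambda_c$ (with $1/0=\infty$). Then, in the absence of fading (all fading gains $h\equiv 1$), both of the following hold. (a) There is $\lambda_c'\ge 0$ such that for all $\lambda_0\ge\lambda_c'$ $$\int_0^\infty\!\!\int_0^\infty 2\pi\lambda_0\, r\,t\,\exp\Big(-\pi\lambda_0 r^2-2\pi\lambda_0\int_r^\infty x\big(1-e^{-tL(x)}\big)\,dx\Big)\,dr\,dt<\infty .$$ (b) There is $\lambda_c''\ge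 0$ such that for all $\lambda_0\ge\lambda_c''$ and every homogeneous Poisson point process $\Psi$ of intensity $\lambda_0$ in $\mathbb R^2$, the interference at the origin from all points of $\Psi$ except the closest one, $$\mathcal I=\sum_{x\in\Psi,\ \|x\|>\rho}L(\|x\|),\qquad \rho=\min_{y\in\Psi}\|y\|,$$ has a finite second negative moment: $\mathbb E[\mathcal I^{-2}]<\infty$ (with $1/0=\infty$). -/

import Mathlib

open MeasureTheory ProbabilityTheory Set
open scoped NNReal ENNReal

universe u

namespace UltraDense

/-- The Euclidean plane, in which the base stations are located; the user is at the origin. -/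
abbrev Plane : Type := EuclideanSpace ℝ (Fin 2)

/-- `Ψ` is a homogeneous Poisson point process of intensity `lam` in the plane, as a random locally
finite set of points: the number of points in a Borel set `B` of finite area `|B|` is Poisson with
mean `lam * |B|`, and the numbers of points in disjoint Borel sets are independent. -/
structure IsPoissonPointProcess {Ω : Type*} [MeasurableSpace Ω] (Ψ : Ω → Set Plane) (lam : ℝ≥0)
    (μ : Measure Ω) : Prop where
  locallyFinite : ∀ ω (R : ℝ), (Ψ ω ∩ Metric.closedBall 0 R).Finite
  measurable_count : ∀ B : Set Plane, MeasurableSet B → Measurable fun ω ↦ (Ψ ω ∩ B).encard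
  map_count : ∀ B : Set Plane, MeasurableSet B → volume B < ∞ →
    μ.map (fun ω ↦ (Ψ ω ∩ B).encard) =
      (poissonMeasure (lam * (volume B).toNNReal)).map (Nat.cast : ℕ → ℕ∞)
  indep_count : ∀ (n : ℕ) (B : Fin n → Set Plane), (∀ i, MeasurableSet (B i)) →
    Pairwise (fun i j ↦ Disjoint (B i) (B j)) →
    iIndepFun (fun i ω ↦ (Ψ ω ∩ B i).encard) μ

/-- Physically feasible path loss functions (only the values on `[0, ∞)` matter): nonnegative, at
most `L 0`, and with `γ = ∫₀^∞ r L(r) dr` finite and positive. -/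
structure IsFeasiblePathLoss (L : ℝ → ℝ) : Prop where
  nonneg : ∀ r, 0 ≤ r → 0 ≤ L r
  le_zero : ∀ r, 0 ≤ r → L r ≤ L 0
  integrable : IntegrableOn (fun r ↦ r * L r) (Ioi 0)
  integral_pos : 0 < ∫ r in Ioi (0 : ℝ), r * L r

/-- The interference at the origin from the points of `ψ` other than the closest one, that is, from
the points outside the closed disc around the origin whose radius is the distance to `ψ`. The point
at `x` has fading gain `h x` and path loss `L ‖x‖`. -/
noncomputable def interference (L : ℝ → ℝ) (h : Plane → ℝ) (ψ : Set Plane) : ℝ≥0∞ :=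
  ∑' x : ↥(ψ \ Metric.closedBall 0 (Metric.infDist 0 ψ)), ENNReal.ofReal (h x * L ‖(x : Plane)‖)

/-- Without fading (all gains equal to one), the second negative moment of the interference is
finite for all sufficiently large intensities. It is an expectation in `[0, ∞]` with `1 / 0 = ∞`. -/
def FiniteSecondNegativeMomentNoFading (L : ℝ → ℝ) : Prop :=
  ∃ lamc : ℝ≥0, ∀ lam : ℝ≥0, lamc ≤ lam →
    ∀ (Ω : Type u) [MeasurableSpace Ω] (μ : Measure Ω) [IsProbabilityMeasure μ]
      (Ψ : Ω → Set Plane), IsPoissonPointProcess Ψ lam μ →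
      ∫⁻ ω, (interference L (fun _ ↦ 1) (Ψ ω) ^ 2)⁻¹ ∂μ < ∞

/-- The Laplace-transform integral for fading gains of law `ν`, for intensity `lam`. -/
noncomputable def laplaceIntegral (L : ℝ → ℝ) (ν : Measure ℝ) (lam : ℝ≥0) : ℝ≥0∞ :=
  ∫⁻ t in Ioi (0 : ℝ), ∫⁻ r in Ioi (0 : ℝ), ENNReal.ofReal
    (2 * Real.pi * lam * r * t * Real.exp (-Real.pi * lam * r ^ 2 -
      2 * Real.pi * lam * ∫ x in Ioi r, x * ∫ h, (1 - Real.exp (-h * t * L x)) ∂ν))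

/-- The Laplace-transform integral is finite for all sufficiently large intensities. -/
def FiniteLaplaceIntegral (L : ℝ → ℝ) (ν : Measure ℝ) : Prop :=
  ∃ lamc : ℝ≥0, ∀ lam : ℝ≥0, lamc ≤ lam → laplaceIntegral L ν lam < ∞

/-- The conditions on the tail of the path loss function: on `[r₀, ∞)` it is decreasing and
differentiable with `r L(r) / (-L'(r)) ≥ ζ` (a ratio that counts as infinite where `L'(r) = 0`;
the derivative at the endpoint is one-sided), and `∫_{r₀}^∞ r / L(r)² exp (-π lam r²) dr` is finite
for every intensity above `lamc` (with values in `[0, ∞]`, so `L(r) = 0` makes `1 / L(r)²`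
infinite). -/
structure TailConditions (L : ℝ → ℝ) (r₀ ζ : ℝ) (lamc : ℝ≥0) : Prop where
  r₀_nonneg : 0 ≤ r₀
  ζ_pos : 0 < ζ
  antitone : AntitoneOn L (Ici r₀)
  differentiable : DifferentiableOn ℝ L (Ici r₀)
  ratio : ∀ r, r₀ ≤ r → ζ * (-derivWithin L (Ici r₀) r) ≤ r * L r
  finite_integral : ∀ lam : ℝ≥0, lamc < lam →
    ∫⁻ r in Ioi r₀, ENNReal.ofReal (r * Real.exp (-Real.pi * lam * r ^ 2)) /
      ENNReal.ofReal (L r) ^ 2 < ∞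

end UltraDense

/-! Dividing by `ζ`, the ratio condition reads `L' + r L / ζ ≥ 0`, so `L r * exp (r² / (2ζ))`
increases and `L` decays at most like a Gaussian (`TailConditions.gaussian_le`). Void probabilities
of the Poisson process are Gaussian too, with a rate proportional to the intensity, so they win once
the intensity is large. The integrability condition serves only to make `L r₀` positive.

(a) By the Gaussian bound, `t * L x ≥ 1` up to a radius whose square is `2ζ log (L r₀ * t)`. The
inner integral thus grows like `log t`, and the exponential decays like a power of `t`, with
exponent proportional to the intensity.

(b) This is proved directly, not through (a). If the disc of radius `s` and the annulus from `s` to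
`2s` both contain points, the interference is at least `L (2s)`. Summing `L⁻²` against the void
probabilities over scales `s = N + m` gives a convergent series. -/

namespace UltraDense

/-! ### Gaussian lower bound on the path loss, and the Laplace-transform integral -/

section PathLoss

variable {L : ℝ → ℝ} {r₀ ζ : ℝ} {lamc : ℝ≥0}

/-- The second tail condition forces the path loss to be positive at `r₀`. -/
lemma TailConditions.pos (hT : TailConditions L r₀ ζ lamc) : 0 < L r₀ := by
  by_contra hneg
  have hzero : ∀ r ∈ Ioi r₀, L r ≤ 0 := fun r hr ↦
    (hT.antitone self_mem_Ici (mem_Ici.2 (le_of_lt hr)) (le_of_lt hr)).trans (not_lt.1 hneg)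
  have hfin := hT.finite_integral (lamc + 1) (by simp)
  have htop : ∫⁻ r in Ioi r₀, ENNReal.ofReal (r * Real.exp (-Real.pi * (lamc + 1 : ℝ≥0) * r ^ 2)) /
      ENNReal.ofReal (L r) ^ 2 = ∫⁻ _ in Ioi r₀, ∞ := by
    refine setLIntegral_congr_fun measurableSet_Ioi fun r hr ↦ ?_
    have hr0 : 0 < r := hT.r₀_nonneg.trans_lt hr
    simp only [ENNReal.ofReal_of_nonpos (hzero r hr)]
    rw [zero_pow two_ne_zero]
    -- The numerator must be nonzero, since `0 / 0 = 0`.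
    exact ENNReal.div_zero (ENNReal.ofReal_pos.2 (by positivity)).ne'
  rw [htop] at hfin
  simp at hfin

/-- The ratio condition makes the path loss decay at most like a Gaussian. -/
lemma TailConditions.gaussian_le (hT : TailConditions L r₀ ζ lamc)
    {x : ℝ} (hx : r₀ ≤ x) : L r₀ * Real.exp (-(x ^ 2 / (2 * ζ))) ≤ L x := by
  have hζ := hT.ζ_pos
  have hmono : MonotoneOn (fun y ↦ L y * Real.exp (y ^ 2 / (2 * ζ))) (Ici r₀) := by
    have hderiv : ∀ y ∈ Ioi r₀, HasDerivAt (fun y ↦ L y * Real.exp (y ^ 2 / (2 * ζ)))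
        (derivWithin L (Ici r₀) y * Real.exp (y ^ 2 / (2 * ζ)) +
          L y * (Real.exp (y ^ 2 / (2 * ζ)) * (2 * y / (2 * ζ)))) y := by
      intro y hy
      have h1 : HasDerivAt L (derivWithin L (Ici r₀) y) y :=
        (hT.differentiable y (mem_Ici.2 (le_of_lt hy))).hasDerivWithinAt.hasDerivAt (Ici_mem_nhds hy)
      have h2 : HasDerivAt (fun y : ℝ ↦ y ^ 2 / (2 * ζ)) (2 * y / (2 * ζ)) y := by
        simpa using (hasDerivAt_pow 2 y).div_const (2 * ζ)
      exact h1.mul h2.exp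
    refine monotoneOn_of_deriv_nonneg (convex_Ici r₀)
      (hT.differentiable.continuousOn.mul (by fun_prop)) ?_ ?_
    · rw [interior_Ici]
      exact fun y hy ↦ (hderiv y hy).differentiableAt.differentiableWithinAt
    · rw [interior_Ici]
      intro y hy
      rw [(hderiv y hy).deriv]
      have h := hT.ratio y (le_of_lt hy)
      have h' : 0 ≤ derivWithin L (Ici r₀) y + y * L y / ζ := by
        rw [← neg_le_iff_add_nonneg', le_div_iff₀ hζ]
        linarith
      have heq : derivWithin L (Ici r₀) y * Real.exp (y ^ 2 / (2 * ζ)) +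
          L y * (Real.exp (y ^ 2 / (2 * ζ)) * (2 * y / (2 * ζ))) =
          (derivWithin L (Ici r₀) y + y * L y / ζ) * Real.exp (y ^ 2 / (2 * ζ)) := by
        field_simp
      rw [heq]
      positivity
  have h := hmono self_mem_Ici (mem_Ici.2 hx) hx
  have h0 : L r₀ ≤ L r₀ * Real.exp (r₀ ^ 2 / (2 * ζ)) :=
    le_mul_of_one_le_right (hT.pos).le (Real.one_le_exp (by positivity))
  rw [Real.exp_neg, ← div_eq_mul_inv, div_le_iff₀ (Real.exp_pos _)]
  exact h0.trans h

lemma IsFeasiblePathLoss.integrableOn_one_sub_exp (hL : IsFeasiblePathLoss L) {t : ℝ}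
    (ht : 0 ≤ t) : IntegrableOn (fun x ↦ x * (1 - Real.exp (-t * L x))) (Ioi 0) := by
  -- Measurability of `L` is not assumed; it is recovered from that of `x * L x`.
  have hmeas : AEStronglyMeasurable L (volume.restrict (Ioi 0)) := by
    have h : AEStronglyMeasurable (fun x ↦ x⁻¹ * (x * L x)) (volume.restrict (Ioi (0 : ℝ))) :=
      measurable_inv.aestronglyMeasurable.mul hL.integrable.aestronglyMeasurable
    refine h.congr ((ae_restrict_iff' measurableSet_Ioi).2 (.of_forall fun x hx ↦ ?_))
    exact inv_mul_cancel_left₀ (ne_of_gt hx) _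
  refine Integrable.mono' (hL.integrable.const_mul t) ?_ ?_
  · exact measurable_id.aestronglyMeasurable.mul (aestronglyMeasurable_const.sub
      (Real.continuous_exp.comp_aestronglyMeasurable (hmeas.const_mul (-t))))
  · refine (ae_restrict_iff' measurableSet_Ioi).2 (.of_forall fun x hx ↦ ?_)
    have hx0 : 0 < x := hx
    have hLx := mul_nonneg ht (hL.nonneg x hx0.le)
    have h1 : Real.exp (-t * L x) ≤ 1 := Real.exp_le_one_iff.2 (by linarith)
    have h2 := Real.add_one_le_exp (-t * L x)
    rw [Real.norm_of_nonneg (mul_nonneg hx0.le (by linarith))]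
    nlinarith

lemma IsFeasiblePathLoss.integral_one_sub_exp_nonneg (hL : IsFeasiblePathLoss L) {t r : ℝ}
    (ht : 0 ≤ t) (hr : 0 ≤ r) : 0 ≤ ∫ x in Ioi r, x * (1 - Real.exp (-t * L x)) := by
  refine setIntegral_nonneg measurableSet_Ioi fun x hx ↦ ?_
  have hx0 : 0 ≤ x := hr.trans (le_of_lt hx)
  have hLx := mul_nonneg ht (hL.nonneg x hx0)
  have h1 : Real.exp (-t * L x) ≤ 1 := Real.exp_le_one_iff.2 (by linarith)
  exact mul_nonneg hx0 (by linarith)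

/-- For `x ≥ r₀` with `x² ≤ 2ζ log (L r₀ * t)`, the Gaussian bound gives `t * L x ≥ 1`, hence `1 -
exp (-t * L x) ≥ 1/2`. Integrating `x / 2` over the part of this range beyond `r` gives the bound.
-/
lemma TailConditions.le_integral_one_sub_exp (hL : IsFeasiblePathLoss L)
    (hT : TailConditions L r₀ ζ lamc) {t r : ℝ} (ht : 0 < t) (hr : 0 ≤ r) :
    (2 * ζ * Real.log (L r₀ * t) - r ^ 2 - r₀ ^ 2) / 4 ≤
      ∫ x in Ioi r, x * (1 - Real.exp (-t * L x)) := by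
  have hζ := hT.ζ_pos
  have hr₀ := hT.r₀_nonneg
  have hc := hT.pos
  have hnn := hL.integral_one_sub_exp_nonneg ht.le hr
  set V := 2 * ζ * Real.log (L r₀ * t) with hV
  set m := max r r₀ with hm
  have hm0 : 0 ≤ m := hr.trans (le_max_left _ _)
  have hmsq : m ^ 2 ≤ r ^ 2 + r₀ ^ 2 := by
    rcases max_choice r r₀ with h | h <;> rw [hm, h] <;> nlinarith [sq_nonneg r, sq_nonneg r₀]
  -- If `V ≤ m²`, the claimed lower bound is nonpositive.
  rcases le_or_gt V (m ^ 2) with h | h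
  · linarith
  have hV0 : 0 ≤ V := (sq_nonneg m).trans h.le
  have hmR : m ≤ √V := Real.le_sqrt_of_sq_le h.le
  have hsub : Ioc m √V ⊆ Ioi r := fun x hx ↦ (le_max_left r r₀).trans_lt hx.1
  have hint : IntegrableOn (fun x ↦ x * (1 - Real.exp (-t * L x))) (Ioi r) :=
    (hL.integrableOn_one_sub_exp ht.le).mono_set (Ioi_subset_Ioi hr)
  calc (V - r ^ 2 - r₀ ^ 2) / 4 ≤ (V - m ^ 2) / 4 := by linarith
    _ = ∫ x in Ioc m √V, x * (1 / 2) := by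
        rw [← intervalIntegral.integral_of_le hmR, intervalIntegral.integral_mul_const,
          integral_id, Real.sq_sqrt hV0]
        ring
    _ ≤ ∫ x in Ioc m √V, x * (1 - Real.exp (-t * L x)) := by
        refine setIntegral_mono_on ?_ (hint.mono_set hsub) measurableSet_Ioc fun x hx ↦ ?_
        · exact (Continuous.integrableOn_Icc (by fun_prop)).mono_set Ioc_subset_Icc_self
        have hx0 : 0 ≤ x := hm0.trans hx.1.le
        refine mul_le_mul_of_nonneg_left ?_ hx0
        have hxV : x ^ 2 ≤ V := (Real.le_sqrt hx0 hV0).1 hx.2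
        have hxlog : x ^ 2 / (2 * ζ) ≤ Real.log (L r₀ * t) := by
          rw [div_le_iff₀ (by positivity)]
          linarith
        have h1 : 1 ≤ t * L x := calc
          1 = t * (L r₀ * Real.exp (-Real.log (L r₀ * t))) := by
            rw [Real.exp_neg, Real.exp_log (by positivity)]
            field_simp
          _ ≤ t * (L r₀ * Real.exp (-(x ^ 2 / (2 * ζ)))) := by gcongr
          _ ≤ t * L x := by
            gcongr
            exact hT.gaussian_le ((le_max_right r r₀).trans hx.1.le)
        have h2 : Real.exp (-t * L x) ≤ Real.exp (-1) := Real.exp_le_exp.2 (by linarith)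
        have h3 : Real.exp (-1) ≤ 1 / 2 := by
          rw [Real.exp_neg, ← one_div]
          exact one_div_le_one_div_of_le two_pos (by linarith [Real.add_one_le_exp 1])
        linarith
    _ ≤ _ := by
        refine setIntegral_mono_set hint ?_ hsub.eventuallyLE
        refine (ae_restrict_iff' measurableSet_Ioi).2 (.of_forall fun x hx ↦ ?_)
        have hx0 : 0 ≤ x := hr.trans (le_of_lt hx)
        have hLx := mul_nonneg ht.le (hL.nonneg x hx0)
        have h1 : Real.exp (-t * L x) ≤ 1 := Real.exp_le_one_iff.2 (by linarith)
        exact mul_nonneg hx0 (by linarith)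

theorem TailConditions.finiteLaplaceIntegral_dirac (hL : IsFeasiblePathLoss L)
    (hT : TailConditions L r₀ ζ lamc) : FiniteLaplaceIntegral L (Measure.dirac 1) := by
  have hζ := hT.ζ_pos
  have hc := hT.pos
  -- For large `t` the integrand is of order `t * t ^ (-π lam ζ)`; this threshold makes it at most
  -- of order `t ^ (-3)`.
  refine ⟨(4 / (Real.pi * ζ)).toNNReal, fun lam hlam ↦ ?_⟩
  have hlam' : 4 / (Real.pi * ζ) ≤ lam := Real.toNNReal_le_iff_le_coe.1 hlam
  set p := Real.pi * lam with hp
  have hpζ : 4 ≤ p * ζ := by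
    rw [div_le_iff₀ (by positivity)] at hlam'
    linarith
  have hp0 : 0 < p := by nlinarith
  set K := Real.exp (p * r₀ ^ 2 / 2)
  set C := ∫⁻ r in Ioi (0 : ℝ), ENNReal.ofReal (2 * p * (r * Real.exp (-(p / 2) * r ^ 2))) with hC
  have hCfin : C < ∞ :=
    ((integrable_mul_exp_neg_mul_sq (half_pos hp0)).const_mul (2 * p)).integrableOn.lintegral_lt_top
  set I : ℝ → ℝ → ℝ := fun t r ↦ ∫ x in Ioi r, x * (1 - Real.exp (-t * L x))
  -- Half of the Gaussian in `r` is kept for the `r`-integral, which becomes the constant `C`; the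
  -- other half will absorb the `r²` lost in the lower bound for `I t r`. Only integrability of `g`
  -- in `t` is left.
  have hinner : ∀ t g : ℝ, 0 < t → 0 ≤ g →
      (∀ r, 0 < r → t * Real.exp (-p * r ^ 2 - 2 * p * I t r) ≤
        g * Real.exp (-(p / 2) * r ^ 2)) →
      ∫⁻ r in Ioi (0 : ℝ), ENNReal.ofReal
        (2 * Real.pi * lam * r * t * Real.exp (-Real.pi * lam * r ^ 2 -
          2 * Real.pi * lam * ∫ x in Ioi r, x * ∫ h, (1 - Real.exp (-h * t * L x))
            ∂(Measure.dirac 1))) ≤ ENNReal.ofReal g * C := by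
    intro t g ht hg hle
    rw [hC, ← lintegral_const_mul _ (by fun_prop)]
    refine setLIntegral_mono' measurableSet_Ioi fun r hr ↦ ?_
    have hr0 : 0 < r := hr
    rw [← ENNReal.ofReal_mul hg]
    refine ENNReal.ofReal_le_ofReal ?_
    simp only [integral_dirac, neg_one_mul]
    have h := mul_le_mul_of_nonneg_left (hle r hr0) (by positivity : 0 ≤ 2 * p * r)
    have e1 : -Real.pi * lam * r ^ 2 -
        2 * Real.pi * lam * (∫ x in Ioi r, x * (1 - Real.exp (-t * L x))) =
        -p * r ^ 2 - 2 * p * I t r := by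
      simp only [I, hp]; ring
    rw [e1]
    calc _ = 2 * p * r * (t * Real.exp (-p * r ^ 2 - 2 * p * I t r)) := by rw [hp]; ring
      _ ≤ _ := h
      _ = _ := by ring
  -- The logarithm is nonnegative only from `T` on; below `T`, `I t r ≥ 0` suffices.
  set T := (L r₀)⁻¹ with hTdef
  have hT0 : 0 < T := inv_pos.2 hc
  unfold laplaceIntegral
  rw [← Ioc_union_Ioi_eq_Ioi hT0.le]
  refine (lintegral_union_le _ _ _).trans_lt (ENNReal.add_lt_top.2 ⟨?_, ?_⟩)
  · refine (setLIntegral_mono' measurableSet_Ioc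
      (g := fun _ ↦ ENNReal.ofReal T * C) fun t ht ↦ ?_).trans_lt ?_
    · rw [Ioc_union_Ioi_eq_Ioi hT0.le]
      refine hinner t T ht.1 hT0.le fun r hr ↦ ?_
      have hI : 0 ≤ I t r := hL.integral_one_sub_exp_nonneg ht.1.le hr.le
      have : -p * r ^ 2 - 2 * p * I t r ≤ -(p / 2) * r ^ 2 := by
        nlinarith [mul_nonneg hp0.le hI, mul_nonneg hp0.le (sq_nonneg r)]
      gcongr
      exact ht.2
    · rw [setLIntegral_const]
      exact ENNReal.mul_lt_top (ENNReal.mul_lt_top ENNReal.ofReal_lt_top hCfin) (by simp)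
  · refine (setLIntegral_mono' measurableSet_Ioi
      (g := fun t ↦ ENNReal.ofReal (K * T ^ 4 * t ^ (-3 : ℝ)) * C) fun t ht ↦ ?_).trans_lt ?_
    · rw [Ioc_union_Ioi_eq_Ioi hT0.le]
      have ht0 : 0 < t := hT0.trans ht
      have hct : 1 ≤ L r₀ * t := by
        have := (inv_lt_iff_one_lt_mul₀' hc).1 ht
        exact this.le
      have hlog := Real.log_nonneg hct
      refine hinner t _ ht0 (by positivity) fun r hr ↦ ?_
      have hI := hT.le_integral_one_sub_exp hL ht0 hr.le
      have hexp : -p * r ^ 2 - 2 * p * I t r ≤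
          p * r₀ ^ 2 / 2 + -(4 * Real.log (L r₀ * t)) + -(p / 2) * r ^ 2 := by
        have h1 := mul_le_mul_of_nonneg_left hI (by positivity : 0 ≤ 2 * p)
        have h2 := mul_le_mul_of_nonneg_right hpζ hlog
        simp only [I]
        linarith
      calc t * Real.exp (-p * r ^ 2 - 2 * p * I t r)
          ≤ t * Real.exp (p * r₀ ^ 2 / 2 + -(4 * Real.log (L r₀ * t)) + -(p / 2) * r ^ 2) := by
            gcongr
        _ = _ := by
            have h4 : Real.exp (4 * Real.log (L r₀ * t)) = (L r₀ * t) ^ 4 := by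
              rw [← Real.exp_log (by positivity : 0 < L r₀ * t), ← Real.exp_nat_mul]
              simp
            have h3 : t ^ (-3 : ℝ) = (t ^ 3)⁻¹ := by
              rw [Real.rpow_neg ht0.le]
              norm_cast
            rw [Real.exp_add, Real.exp_add, Real.exp_neg, h4, h3, hTdef]
            field_simp
            rfl
    · rw [lintegral_mul_const _ (by fun_prop)]
      exact ENNReal.mul_lt_top (((integrableOn_Ioi_rpow_of_lt (by norm_num) hT0).const_mul
        (K * T ^ 4)).lintegral_lt_top) hCfin

end PathLoss

/-! ### Void probabilities and the second negative moment -/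

section Interference

variable {L : ℝ → ℝ} {r₀ ζ : ℝ} {lamc : ℝ≥0}

lemma IsPoissonPointProcess.measure_inter_eq_empty {Ω : Type*} [MeasurableSpace Ω]
    {Ψ : Ω → Set Plane} {lam : ℝ≥0} {μ : Measure Ω} (hΨ : IsPoissonPointProcess Ψ lam μ)
    {B : Set Plane} (hB : MeasurableSet B) (hfin : volume B < ∞) :
    μ {ω | Ψ ω ∩ B = ∅} = ENNReal.ofReal (Real.exp (-(lam * (volume B).toReal))) := by
  have hpre : {ω | Ψ ω ∩ B = ∅} = (fun ω ↦ (Ψ ω ∩ B).encard) ⁻¹' {0} := by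
    ext ω
    simp [encard_eq_zero]
  have hcast : (Nat.cast : ℕ → ℕ∞) ⁻¹' {0} = {0} := by
    ext n
    simp
  rw [hpre, ← Measure.map_apply (hΨ.measurable_count B hB) (measurableSet_singleton 0),
    hΨ.map_count B hB hfin, Measure.map_apply .of_discrete (measurableSet_singleton 0), hcast,
    poissonMeasure_singleton]
  simp
  rfl

/-- The disc of radius `s` or the annulus between the radii `s` and `2 * s` is free of points. -/
def HasVoid (s : ℝ) (ψ : Set Plane) : Prop :=
  ψ ∩ Metric.closedBall 0 s = ∅ ∨ ψ ∩ (Metric.closedBall 0 (2 * s) \ Metric.closedBall 0 s) = ∅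

lemma IsPoissonPointProcess.measurableSet_inter_eq_empty {Ω : Type*} [MeasurableSpace Ω]
    {Ψ : Ω → Set Plane} {lam : ℝ≥0} {μ : Measure Ω} (hΨ : IsPoissonPointProcess Ψ lam μ)
    {B : Set Plane} (hB : MeasurableSet B) : MeasurableSet {ω | Ψ ω ∩ B = ∅} := by
  have hpre : {ω | Ψ ω ∩ B = ∅} = (fun ω ↦ (Ψ ω ∩ B).encard) ⁻¹' {0} := by
    ext ω
    simp [encard_eq_zero]
  rw [hpre]
  exact hΨ.measurable_count B hB (measurableSet_singleton 0)

lemma IsPoissonPointProcess.measurableSet_hasVoid {Ω : Type*} [MeasurableSpace Ω]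
    {Ψ : Ω → Set Plane} {lam : ℝ≥0} {μ : Measure Ω} (hΨ : IsPoissonPointProcess Ψ lam μ)
    (s : ℝ) : MeasurableSet {ω | HasVoid s (Ψ ω)} :=
  (hΨ.measurableSet_inter_eq_empty measurableSet_closedBall).union
    (hΨ.measurableSet_inter_eq_empty (measurableSet_closedBall.diff measurableSet_closedBall))

lemma IsPoissonPointProcess.measure_hasVoid_le {Ω : Type*} [MeasurableSpace Ω]
    {Ψ : Ω → Set Plane} {lam : ℝ≥0} {μ : Measure Ω} (hΨ : IsPoissonPointProcess Ψ lam μ)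
    {s : ℝ} (hs : 0 ≤ s) :
    μ {ω | HasVoid s (Ψ ω)} ≤ ENNReal.ofReal (2 * Real.exp (-(Real.pi * lam * s ^ 2))) := by
  have hvol : ∀ a : ℝ, 0 ≤ a →
      (volume (Metric.closedBall (0 : Plane) a)).toReal = a ^ 2 * Real.pi := by
    intro a ha
    rw [EuclideanSpace.volume_closedBall_fin_two]
    simp [ha, Real.pi_pos.le]
  have hannulus : (volume (Metric.closedBall (0 : Plane) (2 * s) \ Metric.closedBall 0 s)).toReal =
      3 * (s ^ 2 * Real.pi) := by
    have h := measureReal_sdiff (μ := volume)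
      (Metric.closedBall_subset_closedBall (by linarith : s ≤ 2 * s) :
        Metric.closedBall (0 : Plane) s ⊆ Metric.closedBall 0 (2 * s))
      measurableSet_closedBall measure_closedBall_lt_top.ne
    simp only [measureReal_def] at h
    rw [h, hvol _ hs, hvol _ (by linarith)]
    ring
  have h1 := hΨ.measure_inter_eq_empty (B := Metric.closedBall 0 s) measurableSet_closedBall
    measure_closedBall_lt_top
  have h2 := hΨ.measure_inter_eq_empty (B := Metric.closedBall 0 (2 * s) \ Metric.closedBall 0 s)
    (measurableSet_closedBall.diff measurableSet_closedBall)
    ((measure_mono sdiff_subset).trans_lt measure_closedBall_lt_top)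
  rw [hvol s hs] at h1
  rw [hannulus] at h2
  refine (measure_union_le {ω | Ψ ω ∩ Metric.closedBall 0 s = ∅}
    {ω | Ψ ω ∩ (Metric.closedBall 0 (2 * s) \ Metric.closedBall 0 s) = ∅}).trans ?_
  rw [h1, h2, ← ENNReal.ofReal_add (Real.exp_pos _).le (Real.exp_pos _).le]
  refine ENNReal.ofReal_le_ofReal ?_
  have hq : 0 ≤ lam * (s ^ 2 * Real.pi) := by positivity
  have e1 : Real.exp (-(lam * (s ^ 2 * Real.pi))) = Real.exp (-(Real.pi * lam * s ^ 2)) := by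
    ring_nf
  have e2 : Real.exp (-(lam * (3 * (s ^ 2 * Real.pi)))) ≤ Real.exp (-(Real.pi * lam * s ^ 2)) :=
    Real.exp_le_exp.2 (by linarith)
  linarith

/-- The point in the disc puts the nearest point within `s`, so the point in the annulus is counted
and contributes at least `L (2 * s)`. -/
lemma le_interference_of_not_hasVoid {s : ℝ} {ψ : Set Plane} (hs : r₀ ≤ s)
    (hL : AntitoneOn L (Ici r₀)) (hψ : ¬ HasVoid s ψ) :
    ENNReal.ofReal (L (2 * s)) ≤ interference L (fun _ ↦ 1) ψ := by
  simp only [HasVoid, not_or, ← nonempty_iff_ne_empty] at hψ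
  obtain ⟨⟨y, hyψ, hy⟩, ⟨x, hxψ, hx2, hx1⟩⟩ := hψ
  rw [mem_closedBall_zero_iff] at hy hx2 hx1
  have hdist : Metric.infDist 0 ψ ≤ s := by
    refine (Metric.infDist_le_dist_of_mem hyψ).trans ?_
    rwa [dist_zero_left]
  have hx : x ∈ ψ \ Metric.closedBall 0 (Metric.infDist 0 ψ) :=
    ⟨hxψ, fun h ↦ hx1 ((mem_closedBall_zero_iff.1 h).trans hdist)⟩
  refine le_trans (ENNReal.ofReal_le_ofReal ?_) (ENNReal.le_tsum ⟨x, hx⟩)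
  have hsx : r₀ ≤ ‖x‖ := hs.trans (not_le.1 hx1).le
  simpa using hL (mem_Ici.2 hsx) (mem_Ici.2 (hsx.trans hx2)) hx2

/-- The second negative power of the interference is controlled by the voids at the scales
`N, N + 1, …`. -/
lemma inv_interference_sq_le (hL : IsFeasiblePathLoss L) (hanti : AntitoneOn L (Ici r₀)) {N : ℝ}
    (hN : 0 ≤ N) (hNr : r₀ ≤ N) (ψ : Set Plane) :
    (interference L (fun _ ↦ 1) ψ ^ 2)⁻¹ ≤ (ENNReal.ofReal (L (2 * N)) ^ 2)⁻¹ +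
      ∑' m : ℕ, {ψ | HasVoid (N + m) ψ}.indicator
        (fun _ ↦ (ENNReal.ofReal (L (2 * (N + (m + 1)))) ^ 2)⁻¹) ψ := by
  classical
  have hbound : ∀ m : ℕ, ¬ HasVoid (N + m) ψ → (interference L (fun _ ↦ 1) ψ ^ 2)⁻¹ ≤
      (ENNReal.ofReal (L (2 * (N + m))) ^ 2)⁻¹ := by
    intro m hm
    have hm0 : (0 : ℝ) ≤ m := m.cast_nonneg
    have := le_interference_of_not_hasVoid (by linarith) hanti hm
    gcongr
  -- At the first scale without a void, either it is `N`, or the preceding scale has a void and its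
  -- term in the series pays for the bound.
  by_cases h : ∃ m : ℕ, ¬ HasVoid (N + m) ψ
  · obtain hk | ⟨k, hk⟩ : Nat.find h = 0 ∨ ∃ k, Nat.find h = k + 1 := by
      cases Nat.find h <;> simp
    · have := hbound _ (Nat.find_spec h)
      rw [hk] at this
      simp only [Nat.cast_zero, add_zero] at this
      exact this.trans le_self_add
    · have h1 := hbound _ (Nat.find_spec h)
      rw [hk] at h1
      have h2 : HasVoid (N + k) ψ := not_not.1 (Nat.find_min h (by omega : k < Nat.find h))
      refine le_trans ?_ le_add_self
      refine le_trans ?_ (ENNReal.le_tsum k)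
      rw [indicator_of_mem (by exact h2)]
      exact_mod_cast h1
  · push Not at h
    -- With voids at all scales (an empty `ψ`, for instance), every term is at least `(L 0)⁻² > 0`,
    -- so the right side is infinite.
    have htop : ∑' m : ℕ, {ψ | HasVoid (N + m) ψ}.indicator
        (fun _ ↦ (ENNReal.ofReal (L (2 * (N + (m + 1)))) ^ 2)⁻¹) ψ = ∞ := by
      rw [eq_top_iff]
      refine (ENNReal.tsum_const_eq_top_of_ne_zero (α := ℕ)
        (c := (ENNReal.ofReal (L 0) ^ 2)⁻¹) (by simp)).ge.trans (ENNReal.tsum_le_tsum fun m ↦ ?_)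
      rw [indicator_of_mem (by exact h m)]
      have := hL.le_zero (2 * (N + (m + 1))) (by positivity)
      gcongr
    rw [htop]
    simp

lemma TailConditions.inv_sq_le (hT : TailConditions L r₀ ζ lamc)
    {x : ℝ} (hx : r₀ ≤ x) : (ENNReal.ofReal (L x) ^ 2)⁻¹ ≤
      ENNReal.ofReal ((L r₀ ^ 2)⁻¹ * Real.exp (x ^ 2 / ζ)) := by
  have hc := hT.pos
  have hg := hT.gaussian_le hx
  have hpos : 0 < L r₀ * Real.exp (-(x ^ 2 / (2 * ζ))) := by positivity
  have hLx : 0 < L x := hpos.trans_le hg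
  rw [← ENNReal.ofReal_pow hLx.le, ← ENNReal.ofReal_inv_of_pos (by positivity)]
  refine ENNReal.ofReal_le_ofReal ?_
  have he : (L r₀ ^ 2)⁻¹ * Real.exp (x ^ 2 / ζ) =
      ((L r₀ * Real.exp (-(x ^ 2 / (2 * ζ)))) ^ 2)⁻¹ := by
    rw [mul_pow, mul_inv, ← Real.exp_nat_mul, ← Real.exp_neg]
    congr 2
    have := hT.ζ_pos
    push_cast
    field_simp
  rw [he]
  gcongr

theorem TailConditions.finiteSecondNegativeMomentNoFading (hL : IsFeasiblePathLoss L)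
    (hT : TailConditions L r₀ ζ lamc) : FiniteSecondNegativeMomentNoFading.{u} L := by
  have hζ := hT.ζ_pos
  have hr₀ := hT.r₀_nonneg
  have hc := hT.pos
  -- `16 / ζ` offsets the growth of `L⁻²`; the extra `1` leaves `exp (-s²) ≤ exp (-m)`.
  refine ⟨((16 / ζ + 1) / Real.pi).toNNReal, fun lam hlam Ω _ μ _ Ψ hΨ ↦ ?_⟩
  have hp : 16 / ζ + 1 ≤ Real.pi * lam := by
    have h : (16 / ζ + 1) / Real.pi ≤ lam := Real.toNNReal_le_iff_le_coe.1 hlam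
    rwa [div_le_iff₀' Real.pi_pos] at h
  set N : ℝ := r₀ + 1 with hN
  have hterm : ∀ m : ℕ, (ENNReal.ofReal (L (2 * (N + (m + 1)))) ^ 2)⁻¹ *
      μ {ω | HasVoid (N + m) (Ψ ω)} ≤
        ENNReal.ofReal (2 * (L r₀ ^ 2)⁻¹ * Real.exp (-m)) := by
    intro m
    have hm : (0 : ℝ) ≤ m := m.cast_nonneg
    set s : ℝ := N + m with hs
    have hs1 : 1 ≤ s := by linarith
    have hsm : m ≤ s := by linarith
    refine (mul_le_mul' (hT.inv_sq_le (by linarith))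
      (hΨ.measure_hasVoid_le (by linarith))).trans ?_
    rw [← ENNReal.ofReal_mul (by positivity)]
    refine ENNReal.ofReal_le_ofReal ?_
    -- As `s ≥ 1`, `2 * (s + 1) ≤ 4 * s`.
    have hsq : (2 * (N + (m + 1))) ^ 2 / ζ ≤ 16 / ζ * s ^ 2 := by
      rw [div_mul_eq_mul_div]
      have : N + (m + 1) = s + 1 := by rw [hs]; ring
      rw [this]
      gcongr
      nlinarith
    have hexp : (2 * (N + (m + 1))) ^ 2 / ζ + -(Real.pi * lam * s ^ 2) ≤ -m := by
      have h1 := mul_le_mul_of_nonneg_right hp (sq_nonneg s)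
      nlinarith
    calc _ = 2 * (L r₀ ^ 2)⁻¹ *
          Real.exp ((2 * (N + (m + 1))) ^ 2 / ζ + -(Real.pi * lam * s ^ 2)) := by
            rw [Real.exp_add]; ring
      _ ≤ _ := by gcongr
  have hsum : ∑' m : ℕ, ENNReal.ofReal (2 * (L r₀ ^ 2)⁻¹ * Real.exp (-m)) < ∞ := by
    have := (Real.summable_exp_neg_nat.mul_left (2 * (L r₀ ^ 2)⁻¹))
    exact this.tsum_ofReal_lt_top
  calc ∫⁻ ω, (interference L (fun _ ↦ 1) (Ψ ω) ^ 2)⁻¹ ∂μ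
      ≤ ∫⁻ ω, ((ENNReal.ofReal (L (2 * N)) ^ 2)⁻¹ + ∑' m : ℕ,
          {ω | HasVoid (N + m) (Ψ ω)}.indicator
            (fun _ ↦ (ENNReal.ofReal (L (2 * (N + (m + 1)))) ^ 2)⁻¹) ω) ∂μ :=
        lintegral_mono fun ω ↦
          inv_interference_sq_le hL hT.antitone (by linarith) (by linarith) (Ψ ω)
    _ = (ENNReal.ofReal (L (2 * N)) ^ 2)⁻¹ + ∑' m : ℕ,
          (ENNReal.ofReal (L (2 * (N + (m + 1)))) ^ 2)⁻¹ * μ {ω | HasVoid (N + m) (Ψ ω)} := by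
        rw [lintegral_add_left measurable_const, lintegral_const, measure_univ, mul_one,
          lintegral_tsum fun m ↦ (measurable_const.indicator
            (hΨ.measurableSet_hasVoid _)).aemeasurable]
        simp_rw [lintegral_indicator_const (hΨ.measurableSet_hasVoid _)]
    _ < ∞ := ENNReal.add_lt_top.2
        ⟨(hT.inv_sq_le (by linarith)).trans_lt ENNReal.ofReal_lt_top,
          (ENNReal.tsum_le_tsum hterm).trans_lt hsum⟩

end Interference

end UltraDense

theorem corollary3 (L : ℝ → ℝ) (hL : UltraDense.IsFeasiblePathLoss L)
    (r₀ ζ : ℝ) (lamc : ℝ≥0) (hT : UltraDense.TailConditions L r₀ ζ lamc) :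
    UltraDense.FiniteLaplaceIntegral L (Measure.dirac 1) ∧
      UltraDense.FiniteSecondNegativeMomentNoFading.{u} L :=
  ⟨hT.finiteLaplaceIntegral_dirac hL, hT.finiteSecondNegativeMomentNoFading hL⟩
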